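/- All polynomials below have rational coefficients, and Zariski-closed sets, irreducibility and components are taken with respect to zero sets in complex space of polynomials with rational coefficients. Let $g_1,\dots,g_s\in\mathbb Q[p_0,\dots,p_n]$ be homogeneous polynomials defining a (nonempty) irreducible, generically reduced projective variety $X\subset\mathbb P^n$ of codimension $k$, and let $h_1,\dots,h_k\in\mathbb Q[p_0,\dots,p_n]$ be homogeneous polynomials such that $X$ is an irreducible component of the variety of $h_1,\dots,h_k$. In the indeterminates $u=(u_0,\dots,u_n)$, $p=(p_0,\dots,p_n)$, $\Lambda=(\lambda_1,\dots,\lambda_{k+1})$ put $$F_i=p_i\Bigl(\lambda_1+\tfrac{\partial h_1}{\partial p_i}\lambda_2+\cdots+\tfrac{\partial h_k}{\partial p_i}\lambda_{k+1}\Bigr)-u_i\quad(0\le i\le n),$$ $F_{n+j}=g_j$ $(1\le j\le s)$ and $F_m=p_0+\cdots+p_n-1$ with $m=n+s+1$. Let $J$ be the determinant of the Jacobian matrix of $F_0,\dots,F_n,\ p_0+\cdots+p_n-1,\ h_1,\dots,h_k$ with respect to $p_0,\dots,p_n,\lambda_1,\dots,\lambda_{k+1}$. Let $\mathcal L_{X_J}\subset\mathbb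 C^{n+1}$ be the Zariski closure of the projection to $u$-space of the set of all $(u,p,\Lambda)\in\mathbb C^{n+1}\times\mathbb C^{n+1}\times\mathbb C^{k+1}$ at which $F_0,\dots,F_m$ and $J$ all vanish. Let $\mathcal D_{X_J}\in\mathbb Q[u]$ be the product of generators of the prime ideals of the distinct irreducible components of codimension $1$ of $\mathcal L_{X_J}$, with $\mathcal D_{X_J}=1$ if there are none (it is unique up to a nonzero rational factor). Then there is an affine variety $V\subsetneq\mathbb C^{2n+2}$, defined by polynomials with rational coefficients, such that the following holds for every field $K$ with an embedding $K\subset\mathbb C$ (for example $K=\mathbb Q$ or $K=\mathbb C$) and all $a_0,b_0,\dots,a_n,b_n\in K$ with $(a_0,b_0,\dots,a_n,b_n)\notin V$. Let $F_i(t)$ $(0\le i\le n)$ be obtained from $F_i$ by substituting $a_it+b_i$ for $u_i$. Then the radical of the elimination ideal $$\langle F_0(t),\dots,F_n(t),F_{n+1},\dots,F_m,J\rangle\cap K[t],$$ where the ideal is formed in $K[t,p,\Lambda]$, is the ideal of $K[t]$ generated by $\mathcal D_{X_J}(a_0t+b_0,\dots,a_nt+b_n)$. -/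

import Mathlib

/-!
# Lagrange likelihood equations and the polynomial `D_{X_J}`

All polynomials have rational coefficients, all points are complex, and "closed", "irreducible",
"component" refer to the Zariski topology on complex space whose closed sets are the common zero
sets of families of rational polynomials.
-/

noncomputable section

open MvPolynomial

namespace Likelihood

/-- Indices of the unknowns: `p_0, …, p_n` (left) and `λ_1, …, λ_{k+1}` (right). -/
abbrev Unk (n k : ℕ) : Type := Fin (n + 1) ⊕ Fin (k + 1)

/-- Indices of all the indeterminates: `u_0, …, u_n` (left) and the unknowns (right). -/
abbrev Var (n k : ℕ) : Type := Fin (n + 1) ⊕ Unk n k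

section Model

variable {n k s : ℕ}

/-- The family `g` of homogeneous polynomials defines an irreducible, generically reduced
(nonempty) projective variety in `ℙⁿ`. -/
structure IsModel (g : Fin s → MvPolynomial (Fin (n + 1)) ℚ) : Prop where
  /-- every `g_i` is homogeneous of some degree -/
  homogeneous : ∀ i, ∃ d : ℕ, (g i).IsHomogeneous d
  /-- the projective zero set is nonempty -/
  nonempty : ∃ x : Fin (n + 1) → ℂ, x ≠ 0 ∧ ∀ i, aeval x (g i) = 0
  /-- the zero set is irreducible -/
  irreducible : (Ideal.span (Set.range g)).radical.IsPrime
  /-- the scheme defined by `g` is reduced on some dense basic open set `f ≠ 0` -/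
  genericallyReduced : ∃ f : MvPolynomial (Fin (n + 1)) ℚ,
    f ∉ (Ideal.span (Set.range g)).radical ∧
    ((Ideal.span (Set.range g)).map
      (algebraMap (MvPolynomial (Fin (n + 1)) ℚ) (Localization.Away f))).IsRadical

/-- `h_1, …, h_k` are general model invariants for `g`: the variety of `g` has codimension `k`,
the `h_j` are homogeneous, and the variety of `g` is an irreducible component of the variety
of `h_1, …, h_k`. -/
structure IsGeneralInvariants (g : Fin s → MvPolynomial (Fin (n + 1)) ℚ)
    (h : Fin k → MvPolynomial (Fin (n + 1)) ℚ) : Prop where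
  codim : (Ideal.span (Set.range g)).radical.height = k
  homogeneous : ∀ j, ∃ d : ℕ, (h j).IsHomogeneous d
  component : (Ideal.span (Set.range g)).radical ∈ (Ideal.span (Set.range h)).minimalPrimes

variable (g : Fin s → MvPolynomial (Fin (n + 1)) ℚ) (h : Fin k → MvPolynomial (Fin (n + 1)) ℚ)

/-- The indeterminate `u_i`. -/
def U (k : ℕ) (i : Fin (n + 1)) : MvPolynomial (Var n k) ℚ := X (Sum.inl i)

/-- The indeterminate `p_i`. -/
def P (k : ℕ) (i : Fin (n + 1)) : MvPolynomial (Var n k) ℚ := X (Sum.inr (Sum.inl i))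

/-- The indeterminate `λ_{j+1}`, `0 ≤ j ≤ k`. -/
def L (n : ℕ) (j : Fin (k + 1)) : MvPolynomial (Var n k) ℚ := X (Sum.inr (Sum.inr j))

/-- A polynomial in `p_0, …, p_n`, regarded as a polynomial in `u, p, Λ`. -/
def inP (k : ℕ) : MvPolynomial (Fin (n + 1)) ℚ →ₐ[ℚ] MvPolynomial (Var n k) ℚ := aeval (P k)

/-- `F_i = p_i (λ_1 + (∂h_1/∂p_i) λ_2 + ⋯ + (∂h_k/∂p_i) λ_{k+1}) - u_i`, `0 ≤ i ≤ n`. -/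
def F (i : Fin (n + 1)) : MvPolynomial (Var n k) ℚ :=
  P k i * (L n 0 + ∑ j : Fin k, inP k (pderiv i (h j)) * L n j.succ) - U k i

/-- The last Lagrange likelihood equation, `p_0 + ⋯ + p_n - 1`. -/
def sumEq (n k : ℕ) : MvPolynomial (Var n k) ℚ := (∑ i : Fin (n + 1), P k i) - 1

/-- The Lagrange likelihood equations `F_0, …, F_n, g_1, …, g_s, p_0 + ⋯ + p_n - 1`. -/
def lagrangeEqs : Set (MvPolynomial (Var n k) ℚ) :=
  Set.range (F h) ∪ Set.range (fun i => inP k (g i)) ∪ {sumEq n k}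

/-- The Jacobian determinant of `F_0, …, F_n, p_0 + ⋯ + p_n - 1, h_1, …, h_k` with respect to the
unknowns `p_0, …, p_n, λ_1, …, λ_{k+1}`. -/
def J : MvPolynomial (Var n k) ℚ :=
  Matrix.det (Matrix.of fun (r c : Unk n k) =>
    pderiv (Sum.inr c) (Sum.elim (F h) (Fin.cons (sumEq n k) fun j => inP k (h j)) r))

/-- The Lagrange likelihood correspondence, a set of complex points `(u, p, Λ)`. -/
def correspondence : Set (Var n k → ℂ) := zeroLocus ℂ (Ideal.span (lagrangeEqs g h))

/-- The projection of `(u, p, Λ)` to `u`. -/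
def proj (z : Var n k → ℂ) : Fin (n + 1) → ℂ := fun i => z (Sum.inl i)

/-- The Zariski closure of the projection of the part of the Lagrange likelihood correspondence
where `J` vanishes. -/
def LXJ : Set (Fin (n + 1) → ℂ) :=
  zeroLocus ℂ (vanishingIdeal ℚ
    (proj '' (correspondence g h ∩ zeroLocus ℂ (Ideal.span {J h}))))

/-- `D` is (a choice, up to a nonzero rational factor, of) `D_{X_J}`: the product of generators
`D_1, …, D_K` of the prime ideals of the distinct irreducible components of codimension one of
`LXJ`; the empty product `1` if there is no such component. The `D_j` are automatically
homogeneous, since `LXJ` is a cone. -/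
def IsDXJ (D : MvPolynomial (Fin (n + 1)) ℚ) : Prop :=
  ∃ (K : ℕ) (d : Fin K → MvPolynomial (Fin (n + 1)) ℚ),
    Function.Injective (fun j => Ideal.span {d j}) ∧
    Set.range (fun j => Ideal.span {d j}) =
      {Q | Q ∈ (vanishingIdeal ℚ (LXJ g h)).minimalPrimes ∧ Q.height = 1} ∧
    D = ∏ j, d j

end Model

section Line

variable {n k s : ℕ} {K : Type} [Field K] [CharZero K]

/-- The substitution `u_i ↦ a_i t + b_i` from `ℚ[u, p, Λ]` to `K[t, p, Λ]`, where `t` is the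
variable with index `Sum.inl ()`. -/
def lineSubst (k : ℕ) (a b : Fin (n + 1) → K) :
    MvPolynomial (Var n k) ℚ →ₐ[ℚ] MvPolynomial (Unit ⊕ Unk n k) K :=
  aeval (Sum.elim (fun i => C (a i) * X (Sum.inl ()) + C (b i)) (fun y => X (Sum.inr y)))

/-- The elimination ideal
`⟨F_0(t), …, F_n(t), F_{n+1}, …, F_m, J⟩ ∩ K[t]` for the line `u_i = a_i t + b_i`. -/
def lineElimIdeal (g : Fin s → MvPolynomial (Fin (n + 1)) ℚ)
    (h : Fin k → MvPolynomial (Fin (n + 1)) ℚ) (a b : Fin (n + 1) → K) : Ideal (Polynomial K) :=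
  (Ideal.span (lineSubst k a b '' (lagrangeEqs g h ∪ {J h}))).comap
    (Polynomial.aeval (X (Sum.inl ()) : MvPolynomial (Unit ⊕ Unk n k) K))

/-- `D(a_0 t + b_0, …, a_n t + b_n) ∈ K[t]`. -/
def lineRestrict (D : MvPolynomial (Fin (n + 1)) ℚ) (a b : Fin (n + 1) → K) : Polynomial K :=
  aeval (fun i => Polynomial.C (a i) * Polynomial.X + Polynomial.C (b i)) D

end Line

end Likelihood

end

open MvPolynomial

/-! Let B be the projection to u-space of the common zeros of the Lagrange equations and `J`. By the
Nullstellensatz, the radical of the elimination ideal on a line consists of the polynomials in t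
that vanish whenever the point with parameter t lies in B itself, not merely in its closure
(`mem_radical_lineElimIdeal_iff`). So it suffices that, on a general line, the restriction of `D` is
separable and its complex roots are exactly the parameters of points of B.

Three facts give this. On the generic line, a prime d and a polynomial it does not divide satisfy a
Bézout identity whose right side is a nonzero polynomial in (a, b). Hence outside a hypersurface of
lines their restrictions are coprime, and likewise d and its derivative along the line. This gives
separability and lets the line avoid every component of codimension at least two. By Chevalley's
theorem, B contains each codimension-one component up to a proper closed subset, which a general
line also avoids on that component.

Finally B is not dense, so no component is the whole space. Otherwise the correspondence would have
a point over a field with algebraically independent u-coordinates and `J` = 0. A transcendence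
degree count makes the gradients independent at such a point, and derivations with arbitrary values
on the u-coordinates make the Jacobian matrix surjective, so `J` ≠ 0 (`aeval_J_ne_zero`). -/

/-! ### Bézout identities over a unique factorization domain -/

theorem Polynomial.exists_map_eq_C_mul {R : Type*} [CommRing R] [IsDomain R]
    (Q : Polynomial (FractionRing R)) :
    ∃ c : R, c ≠ 0 ∧ ∃ Q' : Polynomial R,
      Q'.map (algebraMap R (FractionRing R)) = Polynomial.C (algebraMap R _ c) * Q := by
  obtain ⟨c, hc0, hc⟩ := IsLocalization.integerNormalization_spec (nonZeroDivisors R) Q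
  refine ⟨c, nonZeroDivisors.ne_zero hc0, _, hc.trans ?_⟩
  rw [← Polynomial.smul_eq_C_mul, algebraMap_smul]

/-- A prime polynomial over a unique factorization domain and a polynomial it does not divide
generate an ideal containing a nonzero constant. -/
theorem Polynomial.exists_bezout_of_prime_of_not_dvd {R : Type*} [CommRing R] [IsDomain R]
    [UniqueFactorizationMonoid R] {A B : Polynomial R} (hA : Prime A) (h : ¬ A ∣ B) :
    ∃ r : R, r ≠ 0 ∧ ∃ α β, α * A + β * B = Polynomial.C r := by
  have hinj := IsFractionRing.injective R (FractionRing R)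
  by_cases hdeg : A.natDegree = 0
  · obtain ⟨c, rfl⟩ := Polynomial.natDegree_eq_zero.1 hdeg
    exact ⟨c, by rintro rfl; simp at hA, 1, 0, by simp⟩
  -- Gauss's lemma: A stays irreducible over the fraction field, where coprimality is Bézout.
  -- Clearing denominators at the end produces the constant.
  have hirr : Irreducible (A.map (algebraMap R (FractionRing R))) := by
    classical
    exact ((hA.irreducible.isPrimitive hdeg).irreducible_iff_irreducible_map_fraction_map).1
      hA.irreducible
  have hndvd : ¬ A.map (algebraMap R (FractionRing R)) ∣ B.map (algebraMap R _) := by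
    rintro ⟨Q, hQ⟩
    obtain ⟨c, hc, Q', hQ'⟩ := Polynomial.exists_map_eq_C_mul Q
    have : Polynomial.C c * B = A * Q' := by
      apply Polynomial.map_injective _ hinj
      rw [Polynomial.map_mul, Polynomial.map_mul, hQ', hQ, Polynomial.map_C]
      ring
    rcases hA.dvd_or_dvd (this ▸ dvd_mul_right A Q') with h' | h'
    · have := Polynomial.natDegree_le_of_dvd h' (by simpa using hc)
      simp at this
      exact hdeg this
    · exact h h'
  obtain ⟨a, b, hab⟩ := (hirr.coprime_iff_not_dvd).2 hndvd
  obtain ⟨c, hc, a', ha'⟩ := Polynomial.exists_map_eq_C_mul a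
  obtain ⟨e, he, b', hb'⟩ := Polynomial.exists_map_eq_C_mul b
  refine ⟨c * e, mul_ne_zero hc he, Polynomial.C e * a', Polynomial.C c * b', ?_⟩
  apply Polynomial.map_injective _ hinj
  simp only [Polynomial.map_add, Polynomial.map_mul, ha', hb', Polynomial.map_C, map_mul]
  linear_combination (Polynomial.C (algebraMap R (FractionRing R) c) *
    Polynomial.C (algebraMap R (FractionRing R) e)) * hab

theorem Polynomial.not_dvd_derivative {R : Type*} [CommRing R] [IsDomain R] [CharZero R]
    {A : Polynomial R} (hA : A.natDegree ≠ 0) : ¬ A ∣ A.derivative := by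
  intro h
  have h0 : A.derivative ≠ 0 := fun h0 => hA (Polynomial.derivative_eq_zero.1 h0)
  have := Polynomial.natDegree_le_of_dvd h h0
  have := Polynomial.natDegree_derivative_lt hA
  omega

namespace Likelihood

/-! ### Restriction to the generic line -/

section GenericLine

variable {σ : Type*}

/-- Restriction of a polynomial to the generic line `u = a t + b`. -/
noncomputable def genericLine (σ : Type*) :
    MvPolynomial σ ℚ →ₐ[ℚ] Polynomial (MvPolynomial (σ ⊕ σ) ℚ) :=
  aeval fun i => Polynomial.C (X (Sum.inl i)) * Polynomial.X + Polynomial.C (X (Sum.inr i))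

/-- The automorphism `b ↦ b + a t` of `ℚ[a, b, t]`. -/
noncomputable def shear (σ : Type*) :
    MvPolynomial (Option (σ ⊕ σ)) ℚ ≃ₐ[ℚ] MvPolynomial (Option (σ ⊕ σ)) ℚ :=
  AlgEquiv.ofAlgHom
    (aeval fun o => o.elim (X none) (Sum.elim (fun i => X (some (Sum.inl i)))
      fun i => X (some (Sum.inr i)) + X (some (Sum.inl i)) * X none))
    (aeval fun o => o.elim (X none) (Sum.elim (fun i => X (some (Sum.inl i)))
      fun i => X (some (Sum.inr i)) - X (some (Sum.inl i)) * X none))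
    (by ext o; rcases o with _ | i | i <;> simp)
    (by ext o; rcases o with _ | i | i <;> simp)

/-- Up to an automorphism, restriction to the generic line only renames u to b. Primality and
non-divisibility therefore carry over. -/
theorem genericLine_eq (f : MvPolynomial σ ℚ) :
    genericLine σ f = optionEquivLeft ℚ (σ ⊕ σ) (shear σ (rename (some ∘ Sum.inr) f)) := by
  have : genericLine σ = ((optionEquivLeft ℚ (σ ⊕ σ)).toAlgHom.comp (shear σ).toAlgHom).comp
      (rename (some ∘ Sum.inr)) := by
    ext i : 1
    simp [genericLine, shear, optionEquivLeft_X_some, optionEquivLeft_X_none, add_comm]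
  exact DFunLike.congr_fun this f

theorem prime_rename_of_injective {τ R : Type*} [CommRing R] {f : σ → τ}
    (hf : Function.Injective f) {p : MvPolynomial σ R} (hp : Prime p) : Prime (rename f p) := by
  have h1 : rename f p = rename ((↑) : Set.range f → τ)
      (renameEquiv R (Equiv.ofInjective f hf) p) := by
    rw [renameEquiv_apply, rename_rename]; rfl
  rw [h1, prime_rename_iff]
  exact (MulEquiv.prime_iff (renameEquiv R (Equiv.ofInjective f hf))).2 hp

theorem dvd_of_rename_dvd {τ R : Type*} [CommRing R] {f : σ → τ}
    (hf : Function.Injective f) {p q : MvPolynomial σ R} (h : rename f p ∣ rename f q) : p ∣ q := by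
  simpa [killCompl_rename_app] using map_dvd (killCompl hf) h

theorem prime_genericLine {d : MvPolynomial σ ℚ} (hd : Prime d) : Prime (genericLine σ d) := by
  rw [genericLine_eq, MulEquiv.prime_iff, MulEquiv.prime_iff]
  exact prime_rename_of_injective ((Option.some_injective _).comp Sum.inr_injective) hd

theorem dvd_of_genericLine_dvd {d f : MvPolynomial σ ℚ}
    (h : genericLine σ d ∣ genericLine σ f) : d ∣ f := by
  rw [genericLine_eq, genericLine_eq, map_dvd_iff, map_dvd_iff] at h
  exact dvd_of_rename_dvd ((Option.some_injective _).comp Sum.inr_injective) h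

/-- With a = u and b = 0, the values at t = 1 and t = 0 are d and its constant term. If t did not
occur they would agree, so d would be zero or a unit. -/
theorem natDegree_genericLine_ne_zero {d : MvPolynomial σ ℚ} (hd : Prime d) :
    (genericLine σ d).natDegree ≠ 0 := by
  intro h
  obtain ⟨c, hc⟩ := Polynomial.natDegree_eq_zero.1 h
  let ev (t : ℚ) : Polynomial (MvPolynomial (σ ⊕ σ) ℚ) →ₐ[ℚ] MvPolynomial σ ℚ :=
    (aeval (Sum.elim X fun _ => 0)).comp
      ((Polynomial.aeval (C t : MvPolynomial (σ ⊕ σ) ℚ)).restrictScalars ℚ)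
  have h1 : (ev 1).comp (genericLine σ) = AlgHom.id ℚ _ := by
    ext i : 1; simp [ev, genericLine]
  have h0 : (ev 0).comp (genericLine σ) = aeval (0 : σ → MvPolynomial σ ℚ) := by
    ext i : 1; simp [ev, genericLine]
  have e1 := DFunLike.congr_fun h1 d
  have e0 := DFunLike.congr_fun h0 d
  simp only [AlgHom.comp_apply, ← hc] at e1 e0
  have : d = C (constantCoeff d) := by
    calc d = ev 1 (Polynomial.C c) := e1.symm
      _ = ev 0 (Polynomial.C c) := by simp [ev]
      _ = _ := by rw [e0, aeval_zero]; rfl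
  by_cases hz : constantCoeff d = 0
  · exact hd.ne_zero (by rw [this, hz, C_0])
  · exact hd.not_isUnit (by rw [this]; exact (isUnit_iff_ne_zero.2 hz).map C)

theorem exists_bezout_genericLine {d f : MvPolynomial σ ℚ} (hd : Prime d) (h : ¬ d ∣ f) :
    ∃ r : MvPolynomial (σ ⊕ σ) ℚ, r ≠ 0 ∧
      ∃ α β, α * genericLine σ d + β * genericLine σ f = Polynomial.C r :=
  Polynomial.exists_bezout_of_prime_of_not_dvd (prime_genericLine hd)
    fun h' => h (dvd_of_genericLine_dvd h')

theorem exists_bezout_genericLine_derivative {d : MvPolynomial σ ℚ} (hd : Prime d) :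
    ∃ r : MvPolynomial (σ ⊕ σ) ℚ, r ≠ 0 ∧
      ∃ α β, α * genericLine σ d + β * (genericLine σ d).derivative = Polynomial.C r :=
  Polynomial.exists_bezout_of_prime_of_not_dvd (prime_genericLine hd)
    (Polynomial.not_dvd_derivative (natDegree_genericLine_ne_zero hd))

end GenericLine

/-! ### Specialization to lines over a field -/

section Specialization

variable {n : ℕ} {K : Type} [Field K] [CharZero K]

/-- Specialization of the coefficients of a generic line. -/
noncomputable def specialize (a b : Fin (n + 1) → K) :
    MvPolynomial (Fin (n + 1) ⊕ Fin (n + 1)) ℚ →ₐ[ℚ] K :=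
  aeval (Sum.elim a b)

theorem map_genericLine (a b : Fin (n + 1) → K) (f : MvPolynomial (Fin (n + 1)) ℚ) :
    (genericLine _ f).map (specialize a b : _ →+* K) = lineRestrict f a b := by
  have : (Polynomial.mapAlgHom (specialize a b)).comp (genericLine _) =
      aeval (fun i => Polynomial.C (a i) * Polynomial.X + Polynomial.C (b i)) := by
    ext i : 1
    simp [genericLine, specialize]
  exact DFunLike.congr_fun this f

theorem isCoprime_of_bezout (a b : Fin (n + 1) → K)
    {A B : Polynomial (MvPolynomial (Fin (n + 1) ⊕ Fin (n + 1)) ℚ)}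
    {r : MvPolynomial (Fin (n + 1) ⊕ Fin (n + 1)) ℚ} (hr : specialize a b r ≠ 0)
    (h : ∃ α β, α * A + β * B = Polynomial.C r) :
    IsCoprime (A.map (specialize a b : _ →+* K)) (B.map (specialize a b : _ →+* K)) := by
  obtain ⟨α, β, h⟩ := h
  have h' := congrArg (Polynomial.map (specialize a b : _ →+* K)) h
  simp only [Polynomial.map_add, Polynomial.map_mul, Polynomial.map_C] at h'
  have hC : Polynomial.C (specialize a b r)⁻¹ * Polynomial.C (specialize a b r) = 1 := by
    rw [← Polynomial.C_mul, inv_mul_cancel₀ hr, Polynomial.C_1]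
  refine ⟨Polynomial.C (specialize a b r)⁻¹ * α.map (specialize a b : _ →+* K),
    Polynomial.C (specialize a b r)⁻¹ * β.map (specialize a b : _ →+* K), ?_⟩
  rw [← hC, mul_assoc, mul_assoc, ← mul_add, h']
  rfl

/-- On a general line, the restrictions of a prime polynomial and of a polynomial that it does not
divide are coprime. -/
theorem exists_isCoprime_lineRestrict {d f : MvPolynomial (Fin (n + 1)) ℚ} (hd : Prime d)
    (h : ¬ d ∣ f) :
    ∃ r : MvPolynomial (Fin (n + 1) ⊕ Fin (n + 1)) ℚ, r ≠ 0 ∧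
      ∀ (K : Type) [Field K] [CharZero K] (a b : Fin (n + 1) → K), specialize a b r ≠ 0 →
        IsCoprime (lineRestrict d a b) (lineRestrict f a b) := by
  obtain ⟨r, hr, hb⟩ := exists_bezout_genericLine hd h
  refine ⟨r, hr, fun K _ _ a b hab => ?_⟩
  rw [← map_genericLine, ← map_genericLine]
  exact isCoprime_of_bezout a b hab hb

theorem exists_separable_lineRestrict {d : MvPolynomial (Fin (n + 1)) ℚ} (hd : Prime d) :
    ∃ r : MvPolynomial (Fin (n + 1) ⊕ Fin (n + 1)) ℚ, r ≠ 0 ∧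
      ∀ (K : Type) [Field K] [CharZero K] (a b : Fin (n + 1) → K), specialize a b r ≠ 0 →
        (lineRestrict d a b).Separable := by
  obtain ⟨r, hr, hb⟩ := exists_bezout_genericLine_derivative hd
  refine ⟨r, hr, fun K _ _ a b hab => ?_⟩
  rw [← map_genericLine, Polynomial.separable_def, Polynomial.derivative_map]
  exact isCoprime_of_bezout a b hab hb

end Specialization

end Likelihood

/-! ### Images of projections -/

namespace MvPolynomial

/-- A point of affine space whose prime ideal is the contraction of a prime ideal `N` lifts to a
zero of `N`. -/
theorem exists_mem_zeroLocus_of_comap_rename_eq {σ τ k Ω : Type*} [Finite τ] [Field k] [Field Ω]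
    [Algebra k Ω] [IsAlgClosed Ω] (N : Ideal (MvPolynomial (σ ⊕ τ) k)) [N.IsPrime] (u : σ → Ω)
    (hN : N.comap (rename Sum.inl : MvPolynomial σ k →ₐ[k] MvPolynomial (σ ⊕ τ) k) =
      RingHom.ker (aeval u : MvPolynomial σ k →ₐ[k] Ω)) :
    ∃ z ∈ zeroLocus Ω N, z ∘ Sum.inl = u := by
  set m := RingHom.ker (aeval u : MvPolynomial σ k →ₐ[k] Ω) with hm
  have : m.IsPrime := RingHom.ker_isPrime _
  let κ := FractionRing (MvPolynomial σ k ⧸ m)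
  let M := FractionRing (MvPolynomial (σ ⊕ τ) k ⧸ N)
  let e : (MvPolynomial σ k ⧸ m) →+* Ω := RingHom.kerLift (aeval u : MvPolynomial σ k →ₐ[k] Ω).toRingHom
  have he : Function.Injective e := RingHom.kerLift_injective _
  let e' : (MvPolynomial σ k ⧸ m) →+* M := (algebraMap _ M).comp
    (Ideal.quotientMap N (rename Sum.inl : MvPolynomial σ k →ₐ[k] _).toRingHom hN.ge)
  have hq : Function.Injective (Ideal.quotientMap N
      (rename Sum.inl : MvPolynomial σ k →ₐ[k] _).toRingHom hN.ge) :=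
    Ideal.quotientMap_injective' hN.le
  have he' : Function.Injective e' := fun x y hxy => hq (IsFractionRing.injective _ M hxy)
  -- The residue field κ of the contraction embeds both in Ω, through u, and in the fraction field M
  -- of the quotient by N. The map to M shows that N extends to a proper ideal of κ[τ], which
  -- therefore has a zero in Ω.
  let E : κ →+* Ω := IsFractionRing.lift he
  let E' : κ →+* M := IsFractionRing.lift he'
  let : Algebra κ Ω := E.toAlgebra
  let ι : MvPolynomial σ k →+* κ := (algebraMap _ κ).comp (Ideal.Quotient.mk m)
  let θ : MvPolynomial (σ ⊕ τ) k →+* MvPolynomial τ κ :=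
    eval₂Hom (C.comp (ι.comp C)) (Sum.elim (fun i => C (ι (X i))) X)
  let ψ : MvPolynomial τ κ →+* M :=
    eval₂Hom E' fun j => algebraMap _ M (Ideal.Quotient.mk N (X (Sum.inr j)))
  have hE (q) : E (ι q) = aeval u q := by
    simp only [E, ι, RingHom.comp_apply, IsFractionRing.lift_algebraMap]; rfl
  have hE' (q) : E' (ι q) = algebraMap _ M (Ideal.Quotient.mk N (rename Sum.inl q)) := by
    simp only [E', ι, RingHom.comp_apply, IsFractionRing.lift_algebraMap]; rfl
  have hψθ : ψ.comp θ = (algebraMap _ M).comp (Ideal.Quotient.mk N) := by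
    ext i
    · simp [ψ, θ, hE']
    · rcases i with i | i <;> simp [ψ, θ, hE']
  have hne : N.map θ ≠ ⊤ := by
    have hle : N.map θ ≤ RingHom.ker ψ := by
      rw [Ideal.map_le_iff_le_comap]
      intro q hq
      have := DFunLike.congr_fun hψθ q
      simp only [RingHom.comp_apply] at this
      rw [Ideal.mem_comap, RingHom.mem_ker, this, Ideal.Quotient.eq_zero_iff_mem.2 hq, map_zero]
    exact fun h => RingHom.ker_ne_top ψ (top_le_iff.1 (h ▸ hle))
  obtain ⟨y, hy⟩ : (zeroLocus Ω (N.map θ)).Nonempty := by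
    rw [Set.nonempty_iff_ne_empty]
    intro h0
    have h1 := vanishingIdeal_zeroLocus_eq_radical (K := Ω) (N.map θ)
    rw [h0, vanishingIdeal_empty, eq_comm, Ideal.radical_eq_top] at h1
    exact hne h1
  refine ⟨Sum.elim u y, fun q hq => ?_, by simp⟩
  have hθ : ((aeval y : MvPolynomial τ κ →ₐ[κ] Ω) : _ →+* Ω).comp θ =
      ((aeval (Sum.elim u y) : MvPolynomial (σ ⊕ τ) k →ₐ[k] Ω) : _ →+* Ω) := by
    ext i
    · have := hE (C i)
      simp only [aeval_C] at this
      simp [θ, RingHom.algebraMap_toAlgebra, this]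
    · rcases i with i | i <;> simp [θ, RingHom.algebraMap_toAlgebra, hE]
  have := DFunLike.congr_fun hθ q
  exact this.symm.trans (hy _ (Ideal.mem_map_of_mem θ hq))

/-- The projection of the zero set of a prime ideal contains a dense open subset of its closure. -/
theorem exists_forall_exists_mem_zeroLocus {σ τ k Ω : Type*} [Finite σ] [Finite τ] [Field k]
    [Field Ω] [Algebra k Ω] [IsAlgClosed Ω] (Q : Ideal (MvPolynomial (σ ⊕ τ) k)) [hQ : Q.IsPrime] :
    ∃ f ∉ Q.comap (rename Sum.inl : MvPolynomial σ k →ₐ[k] MvPolynomial (σ ⊕ τ) k),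
      ∀ u ∈ zeroLocus Ω (Q.comap (rename Sum.inl : MvPolynomial σ k →ₐ[k] _)),
        aeval u f ≠ 0 → ∃ z ∈ zeroLocus Ω Q, z ∘ Sum.inl = u := by
  let φ : MvPolynomial σ k →+* MvPolynomial (σ ⊕ τ) k ⧸ Q :=
    (Ideal.Quotient.mk Q).comp (rename Sum.inl : MvPolynomial σ k →ₐ[k] _).toRingHom
  have hφ : φ.FinitePresentation := by
    apply RingHom.FinitePresentation.of_finiteType.1
    refine RingHom.FiniteType.comp (RingHom.FiniteType.of_surjective _ Ideal.Quotient.mk_surjective) ?_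
    apply RingHom.FiniteType.of_comp_finiteType (f := C)
    have : ((rename Sum.inl : MvPolynomial σ k →ₐ[k] MvPolynomial (σ ⊕ τ) k).toRingHom).comp C =
        algebraMap k _ := by ext; simp
    rw [this, RingHom.finiteType_algebraMap]
    infer_instance
  -- Chevalley: the image is constructible. The basic piece containing the generic point of the
  -- closure is open in that closure, and its defining inequality supplies f.
  obtain ⟨S, hS⟩ := PrimeSpectrum.exists_constructibleSetData_iff.2
    (PrimeSpectrum.isConstructible_range_comap hφ)
  have hmem : PrimeSpectrum.comap φ ⟨⊥, Ideal.isPrime_bot⟩ ∈ S.toSet := hS ▸ ⟨_, rfl⟩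
  have hbot : (PrimeSpectrum.comap φ ⟨⊥, Ideal.isPrime_bot⟩).asIdeal =
      Q.comap (rename Sum.inl : MvPolynomial σ k →ₐ[k] _) := by
    ext q; simp [φ, Ideal.Quotient.eq_zero_iff_mem]
  simp only [PrimeSpectrum.ConstructibleSetData.toSet, Set.mem_iUnion, exists_prop] at hmem
  obtain ⟨D, hDS, hD⟩ := hmem
  simp only [PrimeSpectrum.BasicConstructibleSetData.toSet, Set.mem_sdiff, PrimeSpectrum.mem_zeroLocus,
    hbot, Set.singleton_subset_iff, SetLike.mem_coe] at hD
  refine ⟨D.f, hD.2, fun u hu hf => ?_⟩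
  have : (RingHom.ker (aeval u : MvPolynomial σ k →ₐ[k] Ω)).IsPrime := RingHom.ker_isPrime _
  have hu' : (⟨RingHom.ker (aeval u : MvPolynomial σ k →ₐ[k] Ω), this⟩ : PrimeSpectrum _) ∈
      Set.range (PrimeSpectrum.comap φ) := by
    rw [← hS]
    simp only [PrimeSpectrum.ConstructibleSetData.toSet, Set.mem_iUnion, exists_prop]
    refine ⟨D, hDS, ?_⟩
    simp only [PrimeSpectrum.BasicConstructibleSetData.toSet, Set.mem_sdiff,
      PrimeSpectrum.mem_zeroLocus, Set.singleton_subset_iff, SetLike.mem_coe, RingHom.mem_ker]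
    exact ⟨fun q hq => hu q (hD.1 hq), hf⟩
  obtain ⟨N, hN⟩ := hu'
  have hcomap : (N.asIdeal.comap (Ideal.Quotient.mk Q)).comap
      (rename Sum.inl : MvPolynomial σ k →ₐ[k] MvPolynomial (σ ⊕ τ) k) =
      RingHom.ker (aeval u : MvPolynomial σ k →ₐ[k] Ω) := by
    have := congrArg PrimeSpectrum.asIdeal hN
    exact this
  obtain ⟨z, hz, hzu⟩ := exists_mem_zeroLocus_of_comap_rename_eq _ u hcomap
  refine ⟨z, fun q hq => hz q ?_, hzu⟩
  rw [Ideal.mem_comap, Ideal.Quotient.eq_zero_iff_mem.2 hq]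
  exact zero_mem _

end MvPolynomial

/-! ### Transcendence degree and height -/

/-- The transcendence degree drops under a noninjective surjection of domains. -/
theorem Algebra.trdeg_add_one_le_of_surjective {k B B' : Type} [Field k] [CommRing B] [IsDomain B]
    [CommRing B'] [IsDomain B'] [Algebra k B] [Algebra k B'] (f : B →ₐ[k] B')
    (hf : Function.Surjective f) {b : B} (hb : b ≠ 0) (hfb : f b = 0) :
    Algebra.trdeg k B' + 1 ≤ Algebra.trdeg k B := by
  obtain ⟨s, hs⟩ := exists_isTranscendenceBasis k B'
  choose g hg using hf
  let x : s → B := fun i => g i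
  have hfx : f ∘ x = ((↑) : s → B') := by ext i; simp [x, hg]
  have hind : AlgebraicIndependent k (f ∘ x) := hfx ▸ hs.1
  have hx : AlgebraicIndependent k x := hind.of_comp f
  -- In an algebraic relation for b with nonzero constant coefficient, f kills every term but that
  -- coefficient, contradicting independence of the images.
  have htr : Transcendental (Algebra.adjoin k (Set.range x)) b := by
    intro halg
    obtain ⟨q, hq0, hq⟩ :=
      halg.exists_nonzero_coeff_and_aeval_eq_zero (mem_nonZeroDivisors_of_ne_zero hb)
    apply hq0
    have h1 : f (q.coeff 0) = 0 := by
      rw [Polynomial.aeval_eq_sum_range, Finset.sum_range_succ'] at hq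
      have := congrArg f hq
      simpa [Algebra.smul_def, hfb] using this
    obtain ⟨P, hP⟩ : ∃ P, aeval x P = (q.coeff 0 : B) :=
      (Algebra.adjoin_range_eq_range_aeval k x).le (q.coeff 0).2
    have h2 : P = 0 := by
      apply hind.eq_zero_of_aeval_eq_zero
      rw [← h1, ← hP, ← AlgHom.comp_apply, comp_aeval]; rfl
    exact Subtype.ext (by rw [← hP, h2, map_zero]; rfl)
  have := ((AlgebraicIndependent.option_iff_transcendental hx b).2 htr).cardinalMk_le_trdeg
  rwa [Cardinal.mk_option, hs.cardinalMk_eq_trdeg] at this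

/-- The easy half of the dimension formula for polynomial rings over a field. -/
theorem MvPolynomial.height_add_trdeg_quotient_le {k σ : Type} [Field k] [Fintype σ]
    (P : Ideal (MvPolynomial σ k)) [hP : P.IsPrime] :
    P.height + (Cardinal.toNat (Algebra.trdeg k (MvPolynomial σ k ⧸ P)) : ℕ∞) ≤
      Fintype.card σ := by
  let t (P : PrimeSpectrum (MvPolynomial σ k)) : ℕ :=
    Cardinal.toNat (Algebra.trdeg k (MvPolynomial σ k ⧸ P.asIdeal))
  have hfin (P : PrimeSpectrum (MvPolynomial σ k)) :
      Algebra.trdeg k (MvPolynomial σ k ⧸ P.asIdeal) < Cardinal.aleph0 :=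
    trdeg_lt_aleph0_of_finiteType
  have ht (P) : t P ≤ Fintype.card σ := by
    have := trdeg_le_of_surjective (Ideal.Quotient.mkₐ k P.asIdeal)
      (Ideal.Quotient.mkₐ_surjective k P.asIdeal)
    rw [MvPolynomial.trdeg_of_isDomain, Cardinal.lift_id, Cardinal.mk_fintype] at this
    simpa [t] using Cardinal.toNat_le_toNat this (Cardinal.natCast_lt_aleph0)
  -- A strictly increasing function to ℕ bounds the height; by `ht` the subtraction never truncates.
  have hmono : StrictMono fun P => Fintype.card σ - t P := by
    intro P P' hlt
    have hle : P.asIdeal ≤ P'.asIdeal := hlt.le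
    obtain ⟨b, hb', hb⟩ := SetLike.exists_of_lt (show P.asIdeal < P'.asIdeal from hlt)
    have := Algebra.trdeg_add_one_le_of_surjective (Ideal.Quotient.factorₐ k hle)
      (Ideal.Quotient.factor_surjective hle) (b := Ideal.Quotient.mk _ b)
      (by rwa [Ne, Ideal.Quotient.eq_zero_iff_mem])
      (by simpa [Ideal.Quotient.eq_zero_iff_mem] using hb')
    have h2 := Cardinal.toNat_le_toNat this (hfin P)
    rw [Cardinal.toNat_add (hfin P') Cardinal.one_lt_aleph0, Cardinal.one_toNat] at h2
    have := ht P
    change t P' + 1 ≤ t P at h2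
    show Fintype.card σ - t P < Fintype.card σ - t P'
    omega
  have h := Order.height_le_height_apply_of_strictMono _ hmono ⟨P, hP⟩
  rw [Order.height_nat] at h
  have hh : P.height = Order.height (⟨P, hP⟩ : PrimeSpectrum (MvPolynomial σ k)) :=
    PrimeSpectrum.height_eq_orderHeight ⟨P, hP⟩
  rw [hh]
  calc _ ≤ ((Fintype.card σ - t ⟨P, hP⟩ : ℕ) : ℕ∞) + (t ⟨P, hP⟩ : ℕ∞) := by gcongr
    _ = _ := by rw [← Nat.cast_add, Nat.sub_add_cancel (ht _)]

/-! ### Derivations and the rank of the gradients -/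

theorem Derivation.apply_aeval_mvPolynomial {R A σ : Type*} [Fintype σ] [CommRing R] [CommRing A]
    [Algebra R A] (D : Derivation R A A) (z : σ → A) (G : MvPolynomial σ R) :
    D (aeval z G) = ∑ i, aeval z (pderiv i G) * D (z i) := by
  classical
  induction G using MvPolynomial.induction_on with
  | C r => simp
  | add p q hp hq => simp [hp, hq, add_mul, Finset.sum_add_distrib]
  | mul_X p j hp =>
    simp only [map_mul, aeval_X, D.leibniz, smul_eq_mul, hp, Derivation.leibniz, pderiv_X, map_add]
    simp only [add_mul, Finset.sum_add_distrib, Finset.mul_sum]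
    congr 1
    · rw [Finset.sum_eq_single j] <;> simp +contextual [eq_comm]
    · exact Finset.sum_congr rfl fun i _ => by ring

/-- Derivations with prescribed values on algebraically independent elements. -/
theorem AlgebraicIndependent.exists_derivation {k L ι : Type} [Field k] [CharZero k] [Field L]
    [Algebra k L] [Algebra.EssFiniteType k L] {u : ι → L} (hu : AlgebraicIndependent k u)
    (v : ι → L) : ∃ D : Derivation k L L, ∀ i, D (u i) = v i := by
  let A := MvPolynomial ι k
  let : Algebra A L := (aeval u : MvPolynomial ι k →ₐ[k] L).toRingHom.toAlgebra
  have : IsScalarTower k A L := .of_algebraMap_eq' (by ext; simp [RingHom.algebraMap_toAlgebra])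
  have : FaithfulSMul A L := (faithfulSMul_iff_algebraMap_injective A L).2 hu
  let E := FractionRing A
  let : Algebra E L := FractionRing.liftAlgebra A L
  have : IsScalarTower A E L := inferInstance
  have : IsScalarTower k E L := .of_algebraMap_eq fun x => by
    rw [IsScalarTower.algebraMap_apply k A E, ← IsScalarTower.algebraMap_apply A E L,
      ← IsScalarTower.algebraMap_apply]
  have : CharZero E := charZero_of_injective_algebraMap (algebraMap k E).injective
  have : Algebra.EssFiniteType E L := .of_comp k E L
  have : Algebra.FormallySmooth A E := .of_isLocalization (nonZeroDivisors A)
  have : Algebra.FormallySmooth A L := .comp A E L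
  -- In characteristic zero L is formally smooth over A = k[u], so the cotangent homology
  -- obstructing injectivity vanishes. A retraction then extends derivations from A to L.
  have hinj : Function.Injective (KaehlerDifferential.mapBaseChange k A L) := by
    rw [injective_iff_map_eq_zero]
    intro x hx
    obtain ⟨y, rfl⟩ := (Algebra.H1Cotangent.exact_δ_mapBaseChange k A L x).1 hx
    rw [Subsingleton.elim y 0, map_zero]
  obtain ⟨ρ, hρ⟩ := LinearMap.exists_leftInverse_of_injective _ (LinearMap.ker_eq_bot.2 hinj)
  let D0 : Derivation k A L := mkDerivation k v
  let Λ : TensorProduct A L (Ω[A⁄k]) →ₗ[L] L := D0.liftKaehlerDifferential.liftBaseChange L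
  refine ⟨(Λ ∘ₗ ρ).compDer (KaehlerDifferential.D k L), fun i => ?_⟩
  have h1 : KaehlerDifferential.D k L (u i) =
      KaehlerDifferential.mapBaseChange k A L (1 ⊗ₜ KaehlerDifferential.D k A (X i)) := by
    rw [KaehlerDifferential.mapBaseChange_tmul, one_smul, KaehlerDifferential.map_D]
    exact congrArg _ (aeval_X u i).symm
  have h2 := DFunLike.congr_fun hρ (1 ⊗ₜ KaehlerDifferential.D k A (X i))
  simp only [LinearMap.comp_apply, LinearMap.id_apply] at h2
  show Λ (ρ (KaehlerDifferential.D k L (u i))) = v i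
  rw [h1, h2]
  simp only [Λ, D0, LinearMap.liftBaseChange_tmul, one_smul,
    Derivation.liftKaehlerDifferential_comp_D]
  exact mkDerivation_X k v i

/-- If `n + 1` algebraically independent elements of `L` are multiples of the entries of `λ C`,
where `C` has entries in a subfield of transcendence degree at most `n - k`, then the `k + 1` rows
of `C` are linearly independent. -/
theorem Matrix.mulVec_surjective_of_algebraicIndependent {n k : ℕ} {k₀ F L : Type} [Field k₀]
    [Field F] [Field L] [Algebra k₀ F] [Algebra F L] [Algebra k₀ L] [IsScalarTower k₀ F L]
    (htr : Algebra.trdeg k₀ F + k ≤ n) (C : Matrix (Fin (k + 1)) (Fin (n + 1)) F)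
    (p : Fin (n + 1) → F) (l : Fin (k + 1) → L) (u : Fin (n + 1) → L)
    (hu : AlgebraicIndependent k₀ u)
    (hul : ∀ i, u i = algebraMap F L (p i) * ∑ j, algebraMap F L (C j i) * l j) :
    Function.Surjective C.mulVec := by
  by_contra hsurj
  -- If the column space W had dimension at most k, all u i would lie in an F-algebra with k
  -- generators. Its transcendence degree over k₀ is at most (n - k) + k = n, too small for n + 1
  -- independent elements.
  let W : Submodule F (Fin (k + 1) → F) := LinearMap.range C.mulVecLin
  have hW : Module.finrank F W < k + 1 := by
    have : W < ⊤ := lt_top_iff_ne_top.2 fun h => hsurj (LinearMap.range_eq_top.1 h)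
    simpa using Submodule.finrank_lt this.ne
  let φ : (Fin (k + 1) → F) →ₗ[F] L := Fintype.linearCombination F l
  let V := W.map φ
  have hV : Module.finrank F V ≤ k := by
    have := Submodule.finrank_map_le φ W
    change Module.finrank F V ≤ _ at this
    omega
  let b := Module.finBasis F V
  let N := (aeval (fun i => (b i : L)) : MvPolynomial _ F →ₐ[F] L).range
  have hVN : ∀ x ∈ V, x ∈ N := by
    intro x hx
    have := congrArg (V.subtype) (b.sum_repr ⟨x, hx⟩)
    simp only [map_sum, map_smul, Submodule.subtype_apply] at this
    rw [← this]
    exact sum_mem fun i _ => N.smul_mem ⟨X i, by simp⟩ _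
  have huN (i) : u i ∈ N := by
    rw [hul, ← Algebra.smul_def]
    refine N.smul_mem (hVN _ ⟨C.mulVec (Pi.single i 1), ⟨_, rfl⟩, ?_⟩) _
    simp [φ, Fintype.linearCombination_apply, Algebra.smul_def]
  let u' : Fin (n + 1) → N := fun i => ⟨u i, huN i⟩
  have hu' : AlgebraicIndependent k₀ u' :=
    AlgebraicIndependent.of_comp (N.val.restrictScalars k₀) hu
  have h1 := hu'.cardinalMk_le_trdeg
  rw [← trdeg_add_eq k₀ F (A := N), Cardinal.mk_fin] at h1
  have h2 : Algebra.trdeg F N ≤ k := by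
    have := trdeg_le_of_surjective
      (aeval (fun i => (b i : L)) : MvPolynomial _ F →ₐ[F] L).rangeRestrict
      (AlgHom.rangeRestrict_surjective _)
    rw [MvPolynomial.trdeg_of_isDomain, Cardinal.lift_id, Cardinal.mk_fin] at this
    exact this.trans (by exact_mod_cast hV)
  have h3 : ((n + 1 : ℕ) : Cardinal) ≤ n := h1.trans ((add_le_add_right h2 _).trans htr)
  have : n + 1 ≤ n := by exact_mod_cast h3
  omega

/-! ### Nonvanishing of J at points with independent u-coordinates -/

namespace Likelihood

variable {n k s : ℕ} {g : Fin s → MvPolynomial (Fin (n + 1)) ℚ}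
  {h : Fin k → MvPolynomial (Fin (n + 1)) ℚ}

/-- The zero set of g is a cone through the origin, where the linear form takes the value -1.
Constant members of g are zero because the zero set is nonempty. -/
theorem IsModel.sum_X_sub_one_notMem (hg : IsModel g) :
    (∑ i, X i) - 1 ∉ (Ideal.span (Set.range g)).radical := by
  obtain ⟨x, -, hx⟩ := hg.nonempty
  have h0 : ∀ i, aeval (0 : Fin (n + 1) → ℂ) (g i) = 0 := by
    intro i
    obtain ⟨d, hd⟩ := hg.homogeneous i
    rcases eq_or_ne d 0 with rfl | hd0
    · have hC := totalDegree_eq_zero_iff_eq_C.1 ((totalDegree_zero_iff_isHomogeneous _).2 hd)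
      have := hx i
      rw [hC, aeval_C] at this ⊢
      exact this
    · have : coeff 0 (g i) = 0 := hd.coeff_eq_zero (by simpa using hd0.symm)
      rw [aeval_zero, constantCoeff_eq, this, map_zero]
  intro hmem
  have hle : (Ideal.span (Set.range g)).radical ≤
      RingHom.ker (aeval (0 : Fin (n + 1) → ℂ) : MvPolynomial (Fin (n + 1)) ℚ →ₐ[ℚ] ℂ) := by
    rw [Ideal.IsRadical.radical_le_iff (RingHom.ker_isPrime _).isRadical, Ideal.span_le]
    rintro _ ⟨i, rfl⟩
    exact h0 i
  have := hle hmem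
  simp [RingHom.mem_ker] at this

theorem pderiv_inP (v : Var n k) (q : MvPolynomial (Fin (n + 1)) ℚ) :
    pderiv v (inP k q) = ∑ i, inP k (pderiv i q) * pderiv v (P k i) :=
  Derivation.apply_aeval_mvPolynomial (pderiv v) (P k) q

theorem pderiv_inl_inP (i : Fin (n + 1)) (q : MvPolynomial (Fin (n + 1)) ℚ) :
    pderiv (Sum.inl i) (inP k q) = 0 := by
  simp [pderiv_inP, P]

theorem pderiv_inr_inl_inP (i : Fin (n + 1)) (q : MvPolynomial (Fin (n + 1)) ℚ) :
    pderiv (Sum.inr (Sum.inl i)) (inP k q) = inP k (pderiv i q) := by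
  rw [pderiv_inP, Finset.sum_eq_single i] <;> simp +contextual [P]

theorem pderiv_inl_F (i j : Fin (n + 1)) :
    pderiv (Sum.inl i) (F h j) = -(if i = j then 1 else 0 : MvPolynomial (Var n k) ℚ) := by
  by_cases hij : j = i
  · subst hij; simp [F, P, L, U, Derivation.leibniz, pderiv_inl_inP]
  · simp [F, P, L, U, Derivation.leibniz, pderiv_inl_inP, hij, Ne.symm hij]

/-- The square system of equations whose Jacobian determinant is `J`. -/
noncomputable def system (h : Fin k → MvPolynomial (Fin (n + 1)) ℚ) :
    Unk n k → MvPolynomial (Var n k) ℚ :=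
  Sum.elim (F h) (Fin.cons (sumEq n k) fun j => inP k (h j))

theorem pderiv_inl_system_inr (i : Fin (n + 1)) (j : Fin (k + 1)) :
    pderiv (Sum.inl i) (system h (Sum.inr j)) = 0 := by
  refine Fin.cases ?_ (fun j => ?_) j
  · simp [system, sumEq, P]
  · simp [system, pderiv_inl_inP]

/-- The gradients of `p_0 + ⋯ + p_n - 1, h_1, …, h_k`. -/
noncomputable def gradients (h : Fin k → MvPolynomial (Fin (n + 1)) ℚ) :
    Matrix (Fin (k + 1)) (Fin (n + 1)) (MvPolynomial (Fin (n + 1)) ℚ) :=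
  Matrix.of fun j i => Fin.cons (α := fun _ => MvPolynomial (Fin (n + 1)) ℚ) 1
    (fun j => pderiv i (h j)) j

theorem pderiv_inr_inl_system_inr (i : Fin (n + 1)) (j : Fin (k + 1)) :
    pderiv (Sum.inr (Sum.inl i)) (system h (Sum.inr j)) = inP k (gradients h j i) := by
  refine Fin.cases ?_ (fun j => ?_) j
  · simp only [system, sumEq, gradients, P, Sum.elim_inr, Fin.cons_zero, map_sub, map_sum,
      Matrix.of_apply, map_one, Derivation.map_one_eq_zero, sub_zero]
    rw [Finset.sum_eq_single i] <;> simp +contextual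
  · simp [system, gradients, pderiv_inr_inl_inP]

theorem F_eq (i : Fin (n + 1)) :
    F h i = P k i * ∑ j, inP k (gradients h j i) * L n j - U k i := by
  simp [F, gradients, Fin.sum_univ_succ]

theorem aeval_inP {A : Type*} [CommRing A] [Algebra ℚ A] (z : Var n k → A)
    (q : MvPolynomial (Fin (n + 1)) ℚ) :
    aeval z (inP k q) = aeval (fun i => z (Sum.inr (Sum.inl i))) q := by
  rw [inP, ← AlgHom.comp_apply, comp_aeval]
  simp [P]

/-- The coordinates of a zero of `g` on the affine hyperplane `p_0 + ⋯ + p_n = 1` generate an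
algebra of transcendence degree at most `n - k`. -/
theorem toNat_trdeg_quotient_ker_add_le (hg : IsModel g) (hh : IsGeneralInvariants g h)
    {E : Type} [Field E] [Algebra ℚ E] (ev : MvPolynomial (Fin (n + 1)) ℚ →ₐ[ℚ] E)
    (hle : (Ideal.span (Set.range g)).radical ≤ RingHom.ker ev)
    (hsum : ev ((∑ i, X i) - 1) = 0) :
    Cardinal.toNat (Algebra.trdeg ℚ (MvPolynomial (Fin (n + 1)) ℚ ⧸ RingHom.ker ev)) + k ≤ n := by
  have hRp : (Ideal.span (Set.range g)).radical.IsPrime := hg.irreducible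
  have hker : (RingHom.ker ev).IsPrime := RingHom.ker_isPrime _
  -- The hyperplane cuts the cone properly, so the height rises from k to at least k + 1.
  have hlt : (Ideal.span (Set.range g)).radical < RingHom.ker ev :=
    lt_of_le_of_ne hle fun h => hg.sum_X_sub_one_notMem (h ▸ hsum : _ ∈ _)
  have h1 := height_add_trdeg_quotient_le (RingHom.ker ev)
  have h2 := Ideal.height_add_one_le_of_lt_of_isPrime hlt
  rw [hh.codim] at h2
  have h3 := (add_le_add_left h2 _).trans h1
  rw [Fintype.card_fin] at h3
  have h4 : k + 1 + Cardinal.toNat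
      (Algebra.trdeg ℚ (MvPolynomial (Fin (n + 1)) ℚ ⧸ RingHom.ker ev)) ≤ n + 1 := by
    exact_mod_cast h3
  omega

/-- The gradients are linearly independent at a point of the correspondence with algebraically
independent `u`-coordinates. -/
theorem mulVec_gradients_surjective {E : Type} [Field E] [Algebra ℚ E]
    (ev : MvPolynomial (Fin (n + 1)) ℚ →ₐ[ℚ] E)
    (htrB : Cardinal.toNat
      (Algebra.trdeg ℚ (MvPolynomial (Fin (n + 1)) ℚ ⧸ RingHom.ker ev)) + k ≤ n)
    (l : Fin (k + 1) → E)
    (hu : AlgebraicIndependent ℚ fun i => ev (X i) * ∑ j, ev (gradients h j i) * l j) :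
    Function.Surjective ((gradients h).map ev).mulVec := by
  have hker : (RingHom.ker ev).IsPrime := RingHom.ker_isPrime _
  let B := MvPolynomial (Fin (n + 1)) ℚ ⧸ RingHom.ker ev
  let Fr := FractionRing B
  have hinj : Function.Injective (Ideal.kerLiftAlg ev : B →+* E) := Ideal.kerLiftAlg_injective _
  let : Algebra Fr E := (IsFractionRing.lift hinj).toAlgebra
  have : CharZero E := charZero_of_injective_algebraMap (algebraMap ℚ E).injective
  have : IsScalarTower ℚ Fr E := .of_algebraMap_eq' (Subsingleton.elim _ _)
  let ι : MvPolynomial (Fin (n + 1)) ℚ →+* Fr := (algebraMap B Fr).comp (Ideal.Quotient.mk _)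
  have hι (q) : algebraMap Fr E (ι q) = ev q := IsFractionRing.lift_algebraMap hinj _
  have htr : Algebra.trdeg ℚ Fr + k ≤ n := by
    have : Algebra.IsAlgebraic B Fr := IsLocalization.isAlgebraic Fr (nonZeroDivisors B)
    have h1 := trdeg_add_eq ℚ B (A := Fr)
    rw [trdeg_eq_zero (R := B) (A := Fr), add_zero] at h1
    rw [← h1, ← Cardinal.cast_toNat_of_lt_aleph0
      (trdeg_lt_aleph0_of_finiteType : Algebra.trdeg ℚ B < _)]
    exact_mod_cast htrB
  have hC : Function.Surjective ((gradients h).map ι).mulVec :=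
    Matrix.mulVec_surjective_of_algebraicIndependent htr _ (fun i => ι (X i)) l _ hu
      fun i => by simp only [Matrix.map_apply, hι]
  rw [Matrix.mulVec_surjective_iff_exists_right_inverse] at hC ⊢
  obtain ⟨B', hB'⟩ := hC
  refine ⟨B'.map (algebraMap Fr E), ?_⟩
  have := congrArg (fun M => M.map (algebraMap Fr E)) hB'
  simp only [Matrix.map_mul, Matrix.map_map] at this
  rw [Matrix.map_one _ (map_zero _) (map_one _)] at this
  rw [← this]
  congr 1
  ext j i
  simp [hι]

/-- The value at `z` of the Jacobian matrix of `system h` with respect to the unknowns. -/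
noncomputable def jacobianAt (h : Fin k → MvPolynomial (Fin (n + 1)) ℚ) {E : Type} [Field E]
    [Algebra ℚ E] (z : Var n k → E) : Matrix (Unk n k) (Unk n k) E :=
  Matrix.of fun r c => aeval z (pderiv (Sum.inr c) (system h r))

theorem aeval_J {E : Type} [Field E] [Algebra ℚ E] (z : Var n k → E) :
    aeval z (J h) = (jacobianAt h z).det := by
  rw [J, AlgHom.map_det]; rfl

/-- Apply D to the equations satisfied by z: each `F h i` contains u only as the term -u_i, and the
remaining equations do not contain u. -/
theorem jacobianAt_mulVec_derivation {E : Type} [Field E] [Algebra ℚ E] (z : Var n k → E)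
    (hz : ∀ r, aeval z (system h r) = 0) (D : Derivation ℚ E E) :
    (jacobianAt h z).mulVec (fun c => D (z (Sum.inr c))) =
      Sum.elim (fun i => D (z (Sum.inl i))) 0 := by
  ext r
  have h1 := Derivation.apply_aeval_mvPolynomial D z (system h r)
  rw [hz, map_zero, Fintype.sum_sum_type, eq_comm, add_comm] at h1
  have h2 : (jacobianAt h z).mulVec (fun c => D (z (Sum.inr c))) r =
      -∑ i, aeval z (pderiv (Sum.inl i) (system h r)) * D (z (Sum.inl i)) :=
    eq_neg_of_add_eq_zero_left h1
  rw [h2]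
  rcases r with i | j
  · have : system h (Sum.inl i) = F h i := rfl
    simp [this, pderiv_inl_F, apply_ite]
  · simp [pderiv_inl_system_inr]

/-- `J` does not vanish at a point of the correspondence with algebraically independent
`u`-coordinates. -/
theorem aeval_J_ne_zero (hg : IsModel g) (hh : IsGeneralInvariants g h) {E : Type} [Field E]
    [Algebra ℚ E] [Algebra.EssFiniteType ℚ E] (z : Var n k → E)
    (hz : ∀ q ∈ lagrangeEqs g h, aeval z q = 0)
    (hu : AlgebraicIndependent ℚ fun i => z (Sum.inl i)) : aeval z (J h) ≠ 0 := by
  let ev : MvPolynomial (Fin (n + 1)) ℚ →ₐ[ℚ] E := aeval fun i => z (Sum.inr (Sum.inl i))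
  have hle : (Ideal.span (Set.range g)).radical ≤ RingHom.ker ev := by
    rw [Ideal.IsRadical.radical_le_iff (RingHom.ker_isPrime _).isRadical, Ideal.span_le]
    rintro _ ⟨i, rfl⟩
    have := hz (inP k (g i)) (Or.inl (Or.inr ⟨i, rfl⟩))
    rwa [aeval_inP] at this
  have hhp (j) : ev (h j) = 0 :=
    hle (hh.component.1.2 (Ideal.subset_span ⟨j, rfl⟩))
  have hsum : ev ((∑ i, X i) - 1) = 0 := by
    have := hz (sumEq n k) (Or.inr rfl)
    simpa [sumEq, P, ev] using this
  have hF (i) : z (Sum.inl i) =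
      ev (X i) * ∑ j, ev (gradients h j i) * z (Sum.inr (Sum.inr j)) := by
    have := hz (F h i) (Or.inl (Or.inl ⟨i, rfl⟩))
    rw [F_eq] at this
    simp only [map_sub, map_mul, map_sum, aeval_inP, P, L, U, aeval_X, sub_eq_zero] at this
    rw [← this, aeval_X]
  have hC : Function.Surjective ((gradients h).map ev).mulVec := by
    refine mulVec_gradients_surjective ev (toNat_trdeg_quotient_ker_add_le hg hh ev hle hsum)
      (fun j => z (Sum.inr (Sum.inr j))) ?_
    simpa only [← hF] using hu
  have hsys (r) : aeval z (system h r) = 0 := by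
    rcases r with i | j
    · exact hz _ (Or.inl (Or.inl ⟨i, rfl⟩))
    · refine Fin.cases ?_ (fun j => ?_) j
      · exact hz _ (Or.inr rfl)
      · exact (aeval_inP z (h j)).trans (hhp j)
  have hM : Function.Surjective (jacobianAt h z).mulVec := by
    intro w
    -- The vector (dp, 0) matches w in the gradient rows; a derivation then corrects the `F` rows
    -- without changing the others.
    obtain ⟨dp, hdp⟩ := hC fun j => w (Sum.inr j)
    obtain ⟨D, hD⟩ := hu.exists_derivation
      fun i => w (Sum.inl i) - (jacobianAt h z).mulVec (Sum.elim dp 0) (Sum.inl i)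
    refine ⟨Sum.elim dp 0 + fun c => D (z (Sum.inr c)), ?_⟩
    rw [Matrix.mulVec_add, jacobianAt_mulVec_derivation z hsys]
    ext r
    rcases r with i | j
    · simp [hD]
    · rw [← congrFun hdp j]
      simp [Matrix.mulVec, dotProduct, jacobianAt, pderiv_inr_inl_system_inr, aeval_inP, ev]
  rw [aeval_J]
  exact ((Matrix.isUnit_iff_isUnit_det _).1 (Matrix.mulVec_surjective_iff_isUnit.1 hM)).ne_zero

end Likelihood

/-! ### Divisibility from roots, and primes of height different from one -/

/-- A separable polynomial divides every polynomial that vanishes at its roots in an algebraically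
closed extension. -/
theorem Polynomial.Separable.dvd_of_forall_aeval_eq_zero {K Ω : Type*} [Field K] [Field Ω]
    [Algebra K Ω] [IsAlgClosed Ω] {p q : Polynomial K} (hp : p.Separable)
    (h : ∀ t : Ω, aeval t p = 0 → aeval t q = 0) : p ∣ q := by
  rcases eq_or_ne q 0 with rfl | hq
  · exact dvd_zero p
  rw [← Polynomial.map_dvd_map' (algebraMap K Ω)]
  have hq' : q.map (algebraMap K Ω) ≠ 0 := Polynomial.map_ne_zero hq
  have hp' : p.map (algebraMap K Ω) ≠ 0 := Polynomial.map_ne_zero hp.ne_zero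
  refine (IsAlgClosed.splits _).dvd_of_roots_le_roots hp' ?_
  rw [Multiset.le_iff_subset (Polynomial.nodup_roots (hp.map))]
  intro t ht
  rw [Polynomial.mem_roots hp', Polynomial.IsRoot, Polynomial.eval_map_algebraMap] at ht
  rw [Polynomial.mem_roots hq', Polynomial.IsRoot, Polynomial.eval_map_algebraMap]
  exact h t ht

/-- A nonzero prime ideal of height different from one of a noetherian unique factorization domain
contains a prime element and an element that it does not divide. -/
theorem Ideal.IsPrime.exists_prime_mem_not_dvd {R : Type*} [CommRing R] [IsDomain R]
    [IsNoetherianRing R] [UniqueFactorizationMonoid R] {Q : Ideal R} (hQ : Q.IsPrime)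
    (h0 : Q ≠ ⊥) (h1 : Q.height ≠ 1) : ∃ d ∈ Q, Prime d ∧ ∃ f ∈ Q, ¬ d ∣ f := by
  obtain ⟨d, hdQ, hd⟩ := hQ.exists_mem_prime_of_ne_bot h0
  refine ⟨d, hdQ, hd, ?_⟩
  by_contra! hall
  have hspan : Q = Ideal.span {d} :=
    le_antisymm (fun f hf => Ideal.mem_span_singleton.2 (hall f hf))
      ((Ideal.span_singleton_le_iff_mem _).2 hdQ)
  have : Q.IsPrincipal := ⟨d, hspan⟩
  refine h1 (le_antisymm ?_ ?_)
  · exact Ideal.height_le_one_of_isPrincipal_of_mem_minimalPrimes Q Q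
      ⟨⟨hQ, le_rfl⟩, fun _ h _ => h.2⟩
  · simpa [Order.one_le_iff_ne_zero] using h0

namespace Likelihood

/-! ### Generic lines and the branch set -/

section Generic

variable {n : ℕ}

/-- A property of lines `u = a t + b` holds generically if it holds for all `(a, b)` outside the
zero set of a nonzero rational polynomial, over every field of characteristic zero. -/
def Generic (Φ : ∀ (K : Type) [Field K] [CharZero K], (Fin (n + 1) → K) → (Fin (n + 1) → K) → Prop) :
    Prop :=
  ∃ r : MvPolynomial (Fin (n + 1) ⊕ Fin (n + 1)) ℚ, r ≠ 0 ∧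
    ∀ (K : Type) [Field K] [CharZero K] (a b : Fin (n + 1) → K), specialize a b r ≠ 0 → Φ K a b

theorem Generic.and
    {Φ Ψ : ∀ (K : Type) [Field K] [CharZero K], (Fin (n + 1) → K) → (Fin (n + 1) → K) → Prop}
    (hΦ : Generic Φ) (hΨ : Generic Ψ) : Generic fun K _ _ a b => Φ K a b ∧ Ψ K a b := by
  obtain ⟨r, hr, h⟩ := hΦ
  obtain ⟨r', hr', h'⟩ := hΨ
  refine ⟨r * r', mul_ne_zero hr hr', fun K _ _ a b hab => ?_⟩
  rw [map_mul] at hab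
  exact ⟨h K a b (left_ne_zero_of_mul hab), h' K a b (right_ne_zero_of_mul hab)⟩

theorem Generic.forall {ι : Type*} [Finite ι]
    {Φ : ι → ∀ (K : Type) [Field K] [CharZero K], (Fin (n + 1) → K) → (Fin (n + 1) → K) → Prop}
    (hΦ : ∀ i, Generic (Φ i)) : Generic fun K _ _ a b => ∀ i, Φ i K a b := by
  have := Fintype.ofFinite ι
  choose r hr h using hΦ
  refine ⟨∏ i, r i, Finset.prod_ne_zero_iff.2 fun i _ => hr i, fun K _ _ a b hab i => ?_⟩
  rw [map_prod] at hab
  exact h i K a b (Finset.prod_ne_zero_iff.1 hab i (Finset.mem_univ i))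

end Generic

variable {n k s : ℕ} {g : Fin s → MvPolynomial (Fin (n + 1)) ℚ}
  {h : Fin k → MvPolynomial (Fin (n + 1)) ℚ}

variable (g h) in
/-- The ideal generated by the Lagrange likelihood equations and `J`. -/
noncomputable def ramificationIdeal : Ideal (MvPolynomial (Var n k) ℚ) :=
  Ideal.span (lagrangeEqs g h ∪ {J h})

variable (g h) in
/-- The projection to `u`-space of the zero set of the Lagrange likelihood equations and `J`. -/
def branchSet : Set (Fin (n + 1) → ℂ) := proj '' zeroLocus ℂ (ramificationIdeal g h)

theorem LXJ_eq : LXJ g h = zeroLocus ℂ (vanishingIdeal ℚ (branchSet g h)) := by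
  have : correspondence g h ∩ zeroLocus ℂ (Ideal.span {J h}) =
      zeroLocus ℂ (ramificationIdeal g h) := by
    simp only [correspondence, ramificationIdeal, zeroLocus_span]
    ext z
    simp [or_imp, forall_and, and_comm]
  rw [LXJ, this, branchSet]

theorem vanishingIdeal_LXJ : vanishingIdeal ℚ (LXJ g h) = vanishingIdeal ℚ (branchSet g h) := by
  rw [LXJ_eq]
  exact le_antisymm (vanishingIdeal_anti_mono (zeroLocus_vanishingIdeal_le _))
    (le_vanishingIdeal_zeroLocus _)

theorem vanishingIdeal_branchSet : vanishingIdeal ℚ (branchSet g h) =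
    (ramificationIdeal g h).radical.comap
      (rename Sum.inl : MvPolynomial (Fin (n + 1)) ℚ →ₐ[ℚ] MvPolynomial (Var n k) ℚ) := by
  rw [← vanishingIdeal_zeroLocus_eq_radical (K := ℂ)]
  ext q
  simp only [mem_vanishingIdeal_iff, branchSet, Set.forall_mem_image, Ideal.mem_comap, aeval_rename]
  rfl

/-- Every component of the closure of the branch set is the closure of the projection of an
irreducible closed set. -/
theorem exists_isPrime_comap_eq {Q : Ideal (MvPolynomial (Fin (n + 1)) ℚ)}
    (hQ : Q ∈ (vanishingIdeal ℚ (branchSet g h)).minimalPrimes) :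
    ∃ N : Ideal (MvPolynomial (Var n k) ℚ), N.IsPrime ∧ ramificationIdeal g h ≤ N ∧
      N.comap (rename Sum.inl : MvPolynomial (Fin (n + 1)) ℚ →ₐ[ℚ] _) = Q := by
  rw [vanishingIdeal_branchSet] at hQ
  obtain ⟨N, hN, hle, hcomap⟩ := Ideal.exists_comap_eq_of_mem_minimalPrimes
    (rename Sum.inl : MvPolynomial (Fin (n + 1)) ℚ →ₐ[ℚ] MvPolynomial (Var n k) ℚ).toRingHom Q hQ
  exact ⟨N, hN, Ideal.le_radical.trans hle, hcomap⟩

/-- The branch set is not dense. -/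
theorem vanishingIdeal_branchSet_ne_bot (hg : IsModel g) (hh : IsGeneralInvariants g h) :
    vanishingIdeal ℚ (branchSet g h) ≠ ⊥ := by
  intro hbot
  -- Density would give a prime N over the zero ideal. The tautological point in its residue field
  -- has independent u-coordinates and is a zero of `J`.
  obtain ⟨N, hN, hle, hcomap⟩ := exists_isPrime_comap_eq (g := g) (h := h) (Q := ⊥)
    (by rw [hbot]; exact ⟨⟨Ideal.isPrime_bot, le_rfl⟩, fun _ _ _ => bot_le⟩)
  let B := MvPolynomial (Var n k) ℚ ⧸ N
  let E := FractionRing B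
  let π : MvPolynomial (Var n k) ℚ →ₐ[ℚ] E := (IsScalarTower.toAlgHom ℚ B E).comp
    (Ideal.Quotient.mkₐ ℚ N)
  have hπ (q) : π q = 0 ↔ q ∈ N := by
    rw [← Ideal.Quotient.eq_zero_iff_mem]
    exact map_eq_zero_iff _ (IsFractionRing.injective B E)
  let z : Var n k → E := fun v => π (X v)
  have hz : aeval z = π := algHom_ext fun v => by simp [z]
  have : Algebra.EssFiniteType B E := .of_isLocalization _ (nonZeroDivisors B)
  have : Algebra.EssFiniteType ℚ E := .comp ℚ B E
  refine aeval_J_ne_zero hg hh z (fun q hq => ?_) ?_ ?_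
  · rw [hz, hπ]
    exact hle (Ideal.subset_span (Or.inl hq))
  · rw [algebraicIndependent_iff]
    intro q hq
    have h1 : aeval (fun i => z (Sum.inl i)) q = π (rename Sum.inl q) := by
      rw [← hz, aeval_rename]; rfl
    rw [h1, hπ] at hq
    have : q ∈ (⊥ : Ideal (MvPolynomial (Fin (n + 1)) ℚ)) := hcomap ▸ hq
    simpa using this
  · rw [hz, hπ]
    exact hle (Ideal.subset_span (Or.inr rfl))

/-- A component of codimension one is contained in the branch set up to a proper closed subset. -/
theorem exists_not_dvd_forall_mem_branchSet {d : MvPolynomial (Fin (n + 1)) ℚ}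
    (hd : Ideal.span {d} ∈ (vanishingIdeal ℚ (branchSet g h)).minimalPrimes) :
    ∃ f, ¬ d ∣ f ∧ ∀ u : Fin (n + 1) → ℂ, aeval u d = 0 → aeval u f ≠ 0 → u ∈ branchSet g h := by
  obtain ⟨N, hN, hle, hcomap⟩ := exists_isPrime_comap_eq hd
  obtain ⟨f, hf, hlift⟩ := exists_forall_exists_mem_zeroLocus (Ω := ℂ) N
  rw [hcomap] at hf hlift
  refine ⟨f, fun h => hf (Ideal.mem_span_singleton.2 h), fun u hud huf => ?_⟩
  obtain ⟨z, hz, rfl⟩ := hlift u (by rw [zeroLocus_span]; simpa using hud) huf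
  exact ⟨z, zeroLocus_anti_mono hle hz, rfl⟩

/-! ### Elimination along a line -/

section Line

variable {K : Type} [Field K] [CharZero K] [Algebra K ℂ]

/-- The point with parameter `t` of the line `u = a t + b`. -/
def linePoint (a b : Fin (n + 1) → K) (t : ℂ) : Fin (n + 1) → ℂ :=
  fun i => algebraMap K ℂ (a i) * t + algebraMap K ℂ (b i)

theorem aeval_lineRestrict (a b : Fin (n + 1) → K) (t : ℂ) (f : MvPolynomial (Fin (n + 1)) ℚ) :
    Polynomial.aeval t (lineRestrict f a b) = aeval (linePoint a b t) f := by
  have : ((Polynomial.aeval t : Polynomial K →ₐ[K] ℂ).restrictScalars ℚ).comp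
      (aeval fun i => Polynomial.C (a i) * Polynomial.X + Polynomial.C (b i)) =
      aeval (linePoint a b t) := by
    ext i : 1
    simp [linePoint]
  exact DFunLike.congr_fun this f

theorem aeval_ne_zero_of_isCoprime_lineRestrict {a b : Fin (n + 1) → K}
    {d f : MvPolynomial (Fin (n + 1)) ℚ} (hdf : IsCoprime (lineRestrict d a b) (lineRestrict f a b))
    {t : ℂ} (ht : aeval (linePoint a b t) d = 0) : aeval (linePoint a b t) f ≠ 0 := by
  intro hf
  obtain ⟨α, β, h⟩ := hdf
  have := congrArg (Polynomial.aeval t) h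
  simp [aeval_lineRestrict, ht, hf] at this

/-- Nullstellensatz over K with zeros in ℂ: the complex zeros of the substituted system are the
zeros (u, p, Λ) lying over the line, together with the parameter t. -/
theorem mem_radical_lineElimIdeal_iff (a b : Fin (n + 1) → K) (q : Polynomial K) :
    q ∈ (lineElimIdeal g h a b).radical ↔
      ∀ t : ℂ, linePoint a b t ∈ branchSet g h → Polynomial.aeval t q = 0 := by
  have hsub (x : Unit ⊕ Unk n k → ℂ) (G : MvPolynomial (Var n k) ℚ) :
      aeval x (lineSubst k a b G) =
        aeval (Sum.elim (linePoint a b (x (Sum.inl ()))) (x ∘ Sum.inr)) G := by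
    have : ((aeval x : MvPolynomial (Unit ⊕ Unk n k) K →ₐ[K] ℂ).restrictScalars ℚ).comp
        (lineSubst k a b) =
        aeval (Sum.elim (linePoint a b (x (Sum.inl ()))) (x ∘ Sum.inr)) := by
      ext i : 1
      rcases i with i | i <;> simp [lineSubst, linePoint]
    exact DFunLike.congr_fun this G
  have hpol (x : Unit ⊕ Unk n k → ℂ) : aeval x (Polynomial.aeval
      (X (Sum.inl ()) : MvPolynomial (Unit ⊕ Unk n k) K) q) =
      Polynomial.aeval (x (Sum.inl ())) q := by
    rw [← Polynomial.aeval_algHom_apply, aeval_X]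
  rw [lineElimIdeal, ← Ideal.comap_radical, Ideal.mem_comap,
    ← vanishingIdeal_zeroLocus_eq_radical (K := ℂ), mem_vanishingIdeal_iff, zeroLocus_span]
  simp only [Set.mem_ofPred_eq, Set.forall_mem_image, hsub, hpol, branchSet, ramificationIdeal,
    zeroLocus_span]
  constructor
  · rintro H t ⟨z, hz, hzt⟩
    refine H (Sum.elim (fun _ => t) (z ∘ Sum.inr)) fun G hG => ?_
    convert hz G hG using 2
    rw [Sum.elim_inl, ← hzt]
    ext v
    rcases v with v | v <;> simp [proj]
  · intro H x hx
    exact H _ ⟨_, fun G hG => hx hG, rfl⟩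

end Line

end Likelihood

/-! ### The main theorem -/

open Likelihood in
theorem lemma2 (n k s : ℕ)
    (g : Fin s → MvPolynomial (Fin (n + 1)) ℚ) (h : Fin k → MvPolynomial (Fin (n + 1)) ℚ)
    (hg : Likelihood.IsModel g) (hh : Likelihood.IsGeneralInvariants g h)
    (D : MvPolynomial (Fin (n + 1)) ℚ) (hD : Likelihood.IsDXJ g h D) :
    ∃ I : Ideal (MvPolynomial (Fin (n + 1) ⊕ Fin (n + 1)) ℚ),
      MvPolynomial.zeroLocus ℂ I ≠ Set.univ ∧
      ∀ (K : Type) [Field K] [CharZero K] [Algebra K ℂ] (a b : Fin (n + 1) → K),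
        Sum.elim (fun i => algebraMap K ℂ (a i)) (fun i => algebraMap K ℂ (b i)) ∉
          MvPolynomial.zeroLocus ℂ I →
        Ideal.span {Likelihood.lineRestrict D a b} =
          (Likelihood.lineElimIdeal g h a b).radical := by
  obtain ⟨N, d, hdinj, hdrange, rfl⟩ := hD
  rw [vanishingIdeal_LXJ] at hdrange
  have hdmem (j) : Ideal.span {d j} ∈ (vanishingIdeal ℚ (branchSet g h)).minimalPrimes ∧
      (Ideal.span {d j}).height = 1 := by
    have : Ideal.span {d j} ∈ Set.range fun j => Ideal.span {d j} := ⟨j, rfl⟩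
    rwa [hdrange] at this
  have hdprime (j) : Prime (d j) := by
    have h0 : d j ≠ 0 := fun h0 =>
      Ideal.ne_bot_of_height_eq_one (hdmem j).2 (Ideal.span_singleton_eq_bot.2 h0)
    exact (Ideal.span_singleton_prime h0).1 (hdmem j).1.isPrime
  have hdndvd (i j) (hij : i ≠ j) : ¬ d i ∣ d j := fun hdvd =>
    hij (hdinj (Ideal.span_singleton_eq_span_singleton.2
      (((hdprime i).dvd_prime_iff_associated (hdprime j)).1 hdvd)))
  choose f hfndvd hf using fun j => exists_not_dvd_forall_mem_branchSet (hdmem j).1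
  let T := {Q // Q ∈ (vanishingIdeal ℚ (branchSet g h)).minimalPrimes ∧ Q.height ≠ 1}
  have : Finite T :=
    ((vanishingIdeal ℚ (branchSet g h)).finite_minimalPrimes_of_isNoetherianRing.subset
      fun _ hQ => hQ.1).to_subtype
  -- Since B is not dense these components have codimension at least two; a line on which e and e'
  -- are coprime misses the component.
  have hT (Q : T) : ∃ e ∈ Q.1, Prime e ∧ ∃ e' ∈ Q.1, ¬ e ∣ e' :=
    Q.2.1.isPrime.exists_prime_mem_not_dvd
      (ne_bot_of_le_ne_bot (vanishingIdeal_branchSet_ne_bot hg hh) Q.2.1.le) Q.2.2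
  choose e heQ he e' he'Q he' using hT
  -- The conditions on the line: each d j has simple roots, distinct d j share none, f j is nonzero
  -- at the roots of d j, and the components in T are missed.
  obtain ⟨r, hr, hgen⟩ :=
    ((Generic.forall fun j => exists_separable_lineRestrict (hdprime j)).and
      (Generic.forall fun x : {x : Fin N × Fin N // x.1 ≠ x.2} =>
        exists_isCoprime_lineRestrict (hdprime x.1.1) (hdndvd _ _ x.2))).and
    ((Generic.forall fun j => exists_isCoprime_lineRestrict (hdprime j) (hfndvd j)).and
      (Generic.forall fun Q => exists_isCoprime_lineRestrict (he Q) (he' Q)))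
  refine ⟨Ideal.span {r}, fun huniv => hr ?_, fun K _ _ _ a b hab => ?_⟩
  · apply MvPolynomial.map_injective (algebraMap ℚ ℂ) (algebraMap ℚ ℂ).injective
    rw [map_zero]
    apply MvPolynomial.funext
    intro x
    have : x ∈ zeroLocus ℂ (Ideal.span {r}) := huniv ▸ Set.mem_univ x
    rw [map_zero, eval_map, ← aeval_def]
    exact this r (Ideal.mem_span_singleton_self r)
  have hr' : specialize a b r ≠ 0 := by
    intro h0
    apply hab
    rw [zeroLocus_span]
    intro q hq
    have : aeval (Sum.elim (fun i => algebraMap K ℂ (a i)) fun i => algebraMap K ℂ (b i)) r =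
        algebraMap K ℂ (specialize a b r) := by
      rw [specialize, ← aeval_algebraMap_apply]
      congr 2
      ext i; rcases i with i | i <;> rfl
    rw [Set.mem_singleton_iff.1 hq, this, h0, map_zero]
  obtain ⟨⟨hsep, hcop⟩, hcopf, hcope⟩ := hgen K a b hr'
  have hprod : lineRestrict (∏ j, d j) a b = ∏ j, lineRestrict (d j) a b :=
    map_prod _ _ _
  have hDsep : (lineRestrict (∏ j, d j) a b).Separable := by
    rw [hprod]
    exact Polynomial.separable_prod (fun i j hij => hcop ⟨(i, j), hij⟩) hsep
  have hroots (t : ℂ) : Polynomial.aeval t (lineRestrict (∏ j, d j) a b) = 0 ↔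
      linePoint a b t ∈ branchSet g h := by
    rw [aeval_lineRestrict, map_prod, Finset.prod_eq_zero_iff]
    constructor
    · rintro ⟨j, -, hj⟩
      exact hf j _ hj (aeval_ne_zero_of_isCoprime_lineRestrict (hcopf j) hj)
    · intro ht
      have hker : vanishingIdeal ℚ (branchSet g h) ≤
          RingHom.ker (aeval (linePoint a b t) : MvPolynomial (Fin (n + 1)) ℚ →ₐ[ℚ] ℂ) :=
        fun q hq => hq _ ht
      have : (RingHom.ker
        (aeval (linePoint a b t) : MvPolynomial (Fin (n + 1)) ℚ →ₐ[ℚ] ℂ)).IsPrime :=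
        RingHom.ker_isPrime _
      obtain ⟨Q, hQ, hQle⟩ := Ideal.exists_minimalPrimes_le hker
      by_cases hQ1 : Q.height = 1
      · have : Q ∈ Set.range fun j => Ideal.span {d j} := by rw [hdrange]; exact ⟨hQ, hQ1⟩
        obtain ⟨j, rfl⟩ := this
        exact ⟨j, Finset.mem_univ j, hQle (Ideal.mem_span_singleton_self _)⟩
      · exact absurd (hQle (he'Q ⟨Q, hQ, hQ1⟩))
          (aeval_ne_zero_of_isCoprime_lineRestrict (hcope ⟨Q, hQ, hQ1⟩)
            (hQle (heQ ⟨Q, hQ, hQ1⟩)))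
  ext q
  rw [Ideal.mem_span_singleton, mem_radical_lineElimIdeal_iff]
  constructor
  · rintro ⟨q', rfl⟩ t ht
    rw [map_mul, (hroots t).2 ht, zero_mul]
  · intro hq
    exact hDsep.dvd_of_forall_aeval_eq_zero fun t ht => hq t ((hroots t).1 ht)
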